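/- Setting. There are $n$ arms with parameters $p_1,\dots,p_n\in[0,1]$. The responses $X_{t,i}\sim\mathrm{Bern}(p_i)$, $1\le t\le T$, $1\le i\le n$, are independent over arms and over time. Given targets $D_1,\dots,D_T$, a decision maker selects at each time $t$ a (possibly randomized) set $S_t\subseteq[n]$ on the basis of the information available before time $t$, of which $(X_{t,i})_i$ is independent. The loss of a set $S$ at time $t$ is $L_t(S)=\big(\sum_{i\in S}X_{t,i}-D_t\big)^2$, $S_t^*$ is a minimizer of $S\mapsto\mathbb E\,L_t(S)$ over all $S\subseteq[n]$, and $$\mathrm{Regret}(T)=\mathbb E\Big[\sum_{t=1}^T\big(L_t(S_t)-L_t(S_t^*)\big)\Big].$$ Algorithm (CUCB-Avg with parameter $\alpha$). Let $T_i(t)$ be the number of times arm $i$ has been selected by time $t$ (including $t$), and $\bar p_i(t)$ the average of the responses of arm $i$ at those times. Initialization: as long as some arm has never been selected, $S_t$ contains at least one arm that has not been selected before (for instance, $\lceil 2D_t\rceil$ arms are selected each time, taken among the not yet selected ones as long as there are any). At every later time $t$, let $U_i(t)=\min\big(\bar p_i(t-1)+\sqrt{\alpha\log t/(2T_i(t-1))},\,1\big)$,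 rank the arms so that $U_{\sigma(t,1)}(t)\ge\dots\ge U_{\sigma(t,n)}(t)$ (ties broken arbitrarily), let $k_t\ge 0$ be the smallest $k$ with $\sum_{i=1}^{k}\bar p_{\sigma(t,i)}(t-1)>D_t-1/2$, or $k_t=n$ if there is no such $k$, and select $S_t=\{\sigma(t,1),\dots,\sigma(t,k_t)\}$. Constants. Let $p_{\sigma(1)}\ge\dots\ge p_{\sigma(n)}$ be the ordered parameters, $\Delta_i=p_{\sigma(i)}-p_{\sigma(i+1)}$ for $1\le i\le n-1$, $\Delta_{\min}=\min\{\Delta_i:\Delta_i>0\}$, $\beta_{\min}=\min\{p_i:p_i>0\}$ (with $\min\emptyset=+\infty$), $\epsilon_1=\min(\Delta_{\min}/2,\ \beta_{\min}/n)$ (with $1/\epsilon_1^2=0$ if $\epsilon_1=+\infty$), and $\bar M=\max(\bar D^2,n^2)$. Theorem. Suppose $\bar D>0$, $0<D_t\le\bar D$ for all $1\le t\le T$, $T>2$ and $\alpha>2$. Then the regret of CUCB-Avg satisfies $$\mathrm{Regret}(T)\le \bar M n+\frac{2\bar M n}{\alpha-2}+\frac{\alpha\bar M n\log T}{2\epsilon_1^2}+2n^2\sqrt{2\alpha\log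 T}\,\sqrt{T+\frac{\alpha\log T}{2\epsilon_1^2}} .$$ In particular, there is a constant $C$, depending only on $n$, $p$, $\alpha$ and $\bar D$, such that $\mathrm{Regret}(T)\le C\sqrt{T\log T}$ for all $T>2$ and all such targets. -/

import Mathlib

open MeasureTheory ProbabilityTheory
open scoped ENNReal

noncomputable section

namespace DemandResponse

variable {n : ℕ}

/-! ### Pathwise quantities
`s t` is the set of arms selected at time `t`, and `x t i` the response of arm `i` at time `t`.
Time steps are `t = 1, 2, …`; values at index `0` are never used. -/

/-- The time steps in `{1, …, t}` at which arm `i` is selected. -/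
def pullTimes (s : ℕ → Finset (Fin n)) (i : Fin n) (t : ℕ) : Finset ℕ :=
  (Finset.Icc 1 t).filter (fun τ => i ∈ s τ)

/-- The number of times arm `i` has been selected by time `t` (including `t`). -/
def pulls (s : ℕ → Finset (Fin n)) (i : Fin n) (t : ℕ) : ℕ :=
  (pullTimes s i t).card

/-- The sample average of arm `i` by time `t` (including `t`). -/
def sampleMean (s : ℕ → Finset (Fin n)) (x : ℕ → Fin n → ℝ) (i : Fin n) (t : ℕ) : ℝ :=
  (∑ τ ∈ pullTimes s i t, x τ i) / (pulls s i t : ℝ)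

/-- The upper confidence bound of arm `i` used at time `t`. -/
def ucb (α : ℝ) (s : ℕ → Finset (Fin n)) (x : ℕ → Fin n → ℝ) (t : ℕ) (i : Fin n) : ℝ :=
  min (sampleMean s x i (t - 1) + √(α * Real.log t / (2 * (pulls s i (t - 1) : ℝ)))) 1

/-- The first `k` arms in the ranking `σ`. -/
def topSet (σ : Equiv.Perm (Fin n)) (k : ℕ) : Finset (Fin n) :=
  Finset.univ.filter (fun i => (σ.symm i : ℕ) < k)

/-- `A` is a result of ranking the arms in a non-increasing order of `U` (ties broken arbitrarily)
and selecting the first `k` of them, where `k` is the smallest `k ≥ 0` for which the estimates `q`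
of the first `k` arms sum up to more than `d - 1/2`, or `k = n` if no such `k` exists. -/
def IsSelection (U q : Fin n → ℝ) (d : ℝ) (A : Finset (Fin n)) : Prop :=
  ∃ σ : Equiv.Perm (Fin n), Antitone (fun j => U (σ j)) ∧
    ∃ k : ℕ,
      (IsLeast {k : ℕ | k ≤ n ∧ d - 1 / 2 < ∑ i ∈ topSet σ k, q i} k ∨
        ((∀ j ≤ n, ∑ i ∈ topSet σ j, q i ≤ d - 1 / 2) ∧ k = n)) ∧
      A = topSet σ k

/-- The rule of CUCB-Avg at time `t` with target `d`. As long as some arm has never been selected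
(initialization), the selected set contains an arm that has not been selected before; this covers
selecting `⌈2 d⌉ ≥ 1` arms each time, taken among the arms that have not been selected as long as
there are any. Afterwards the arms are ranked by upper confidence bounds, and the sample averages
determine how many of them are selected. -/
def CUCBAvgStep (α d : ℝ) (s : ℕ → Finset (Fin n)) (x : ℕ → Fin n → ℝ) (t : ℕ) : Prop :=
  ((∃ i, pulls s i (t - 1) = 0) → ∃ i ∈ s t, pulls s i (t - 1) = 0) ∧
  ((∀ i, pulls s i (t - 1) ≠ 0) →
    IsSelection (ucb α s x t) (fun i => sampleMean s x i (t - 1)) d (s t))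

/-! ### The stochastic model -/

/-- The responses `X t i`, `1 ≤ t ≤ T`, are Bernoulli with parameter `p i`, independent over the
customers `i` and over time. `ℱ t` is the information up to time `t` (responses up to time `t`
and possibly additional randomization used by the decision maker), of which later responses are
independent. -/
structure IsResponseModel {Ω : Type*} [mΩ : MeasurableSpace Ω] (μ : Measure Ω) (p : Fin n → ℝ)
    (T : ℕ) (ℱ : Filtration ℕ mΩ) (X : ℕ → Fin n → Ω → ℝ) : Prop where
  measurable : ∀ t ∈ Finset.Icc 1 T, ∀ i, Measurable[ℱ t] (X t i)
  zero_or_one : ∀ t ∈ Finset.Icc 1 T, ∀ i, ∀ᵐ ω ∂μ, X t i ω = 0 ∨ X t i ω = 1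
  prob_one : ∀ t ∈ Finset.Icc 1 T, ∀ i, μ {ω | X t i ω = 1} = ENNReal.ofReal (p i)
  indep_customers : ∀ t ∈ Finset.Icc 1 T, iIndepFun (fun i => X t i) μ
  indep_past : ∀ t ∈ Finset.Icc 1 T,
    Indep (MeasurableSpace.comap (fun ω i => X t i ω) (inferInstance : MeasurableSpace (Fin n → ℝ)))
      (ℱ (t - 1)) μ

/-- The (possibly randomized) selections `S t`, `1 ≤ t ≤ T`, are those of CUCB-Avg with parameter
`α` and targets `D t`: `S t` is determined by the information available before time `t`, and
follows the rule of the algorithm. -/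
structure IsCUCBAvg {Ω : Type*} [mΩ : MeasurableSpace Ω] (α : ℝ) (D : ℕ → ℝ)
    (T : ℕ) (ℱ : Filtration ℕ mΩ) (X : ℕ → Fin n → Ω → ℝ) (S : ℕ → Ω → Finset (Fin n)) :
    Prop where
  predictable : ∀ t ∈ Finset.Icc 1 T, ∀ A : Finset (Fin n), MeasurableSet[ℱ (t - 1)] {ω | S t ω = A}
  step : ∀ t ∈ Finset.Icc 1 T, ∀ ω,
    CUCBAvgStep α (D t) (fun τ => S τ ω) (fun τ i => X τ i ω) t

/-! ### Regret -/

/-- Squared deviation of the total response of the arms in `A` from the target `d`. -/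
def loss (d : ℝ) (x : Fin n → ℝ) (A : Finset (Fin n)) : ℝ :=
  (∑ i ∈ A, x i - d) ^ 2

/-- `A` minimizes the expected loss at time `t` over all subsets. -/
def IsOptimal {Ω : Type*} [MeasurableSpace Ω] (μ : Measure Ω) (D : ℕ → ℝ)
    (X : ℕ → Fin n → Ω → ℝ) (t : ℕ) (A : Finset (Fin n)) : Prop :=
  ∀ B : Finset (Fin n),
    ∫ ω, loss (D t) (fun i => X t i ω) A ∂μ ≤ ∫ ω, loss (D t) (fun i => X t i ω) B ∂μ

/-- The realized total excess loss `∑_{t=1}^T (L_t(S_t) - L_t(S_t^*))`. -/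
def totalExcessLoss {Ω : Type*} (D : ℕ → ℝ) (X : ℕ → Fin n → Ω → ℝ)
    (S : ℕ → Ω → Finset (Fin n)) (Sopt : ℕ → Finset (Fin n)) (T : ℕ) (ω : Ω) : ℝ :=
  ∑ t ∈ Finset.Icc 1 T,
    (loss (D t) (fun i => X t i ω) (S t ω) - loss (D t) (fun i => X t i ω) (Sopt t))

/-- The regret: the expected total excess loss. -/
def regret {Ω : Type*} [MeasurableSpace Ω] (μ : Measure Ω) (D : ℕ → ℝ) (X : ℕ → Fin n → Ω → ℝ)
    (S : ℕ → Ω → Finset (Fin n)) (Sopt : ℕ → Finset (Fin n)) (T : ℕ) : ℝ :=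
  ∫ ω, totalExcessLoss D X S Sopt T ω ∂μ

/-! ### Constants of the bound -/

/-- A ranking of the arms by `p` in a non-increasing order. -/
def ranking (p : Fin n → ℝ) : Equiv.Perm (Fin n) :=
  Tuple.sort (fun i => -p i)

/-- The smallest positive gap between consecutive arms in the ranking, `∞` if there is none. -/
def deltaMin (p : Fin n → ℝ) : ℝ≥0∞ :=
  ⨅ (j : Fin n) (k : Fin n) (_ : (k : ℕ) = j + 1)
    (_ : 0 < p (ranking p j) - p (ranking p k)),
    ENNReal.ofReal (p (ranking p j) - p (ranking p k))

/-- The smallest positive parameter, `∞` if there is none. -/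
def betaMin (p : Fin n → ℝ) : ℝ≥0∞ :=
  ⨅ (i : Fin n) (_ : 0 < p i), ENNReal.ofReal (p i)

/-- `ε₁ = min (Δ_min / 2) (β_min / n)`; it is `∞` exactly if no `p i` is positive. -/
def eps1 (p : Fin n → ℝ) : ℝ≥0∞ :=
  min (deltaMin p / 2) (betaMin p / (n : ℝ≥0∞))

/-- `α log T / (2 ε₁²)`, with value `0` for `ε₁ = ∞`. -/
def explorationTerm (p : Fin n → ℝ) (α : ℝ) (T : ℕ) : ℝ :=
  (ENNReal.ofReal (α * Real.log T) / (2 * eps1 p ^ 2)).toReal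

/-- `M̄ = max (D̄²) (n²)`. -/
def Mbar (n : ℕ) (Dbar : ℝ) : ℝ :=
  max (Dbar ^ 2) ((n : ℝ) ^ 2)

/-- The upper bound on the regret. -/
def regretBound (p : Fin n → ℝ) (α Dbar : ℝ) (T : ℕ) : ℝ :=
  Mbar n Dbar * n + 2 * Mbar n Dbar * n / (α - 2) + Mbar n Dbar * n * explorationTerm p α T
    + 2 * (n : ℝ) ^ 2 * √(2 * α * Real.log T) * √((T : ℝ) + explorationTerm p α T)

end DemandResponse

end

namespace DemandResponse

/-! Each selection is determined by the past and the current responses are independent of it, so the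
regret is an expected sum of offline suboptimalities, measured by squared bias plus variance
(`regret_eq_integral_sum`). Adding arm `i` to `A` changes this loss by `2 p i (∑ j ∈ A, p j - (d -
1/2))`. Hence it is optimal to add arms in decreasing order until the total passes `d - 1/2`, and
missing this threshold by `δ` costs at most `2 δ` as long as `δ` is below every positive parameter
(`expectedLoss_le_of_nearly_critical`).

Suppose that all sample averages lie within their confidence radii. If the selected arms have radii
below `ε₁`, they are correctly ranked, and the sum of their radii can serve as `δ`
(`expectedLoss_le_of_isSelection`). By optimism, only the radii of selected arms matter. So the
excess of a step can be charged to the arms it selects (`expectedLoss_step_le`): the maximal loss if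
one of them is new or still has a large radius, otherwise twice the radii. The charge to an arm
depends only on its selection count, which runs through `0, 1, 2, …`; summing arm by arm gives a
constant, a logarithm and a multiple of `√T` (`sum_selectionCost_le`).

Failed confidence intervals are controlled by exponential supermartingales, with a union bound over
arms and selection counts: the failure probability at time `t` is at most `2 n (t - 1) t ^ (-α)`,
summable because `α > 2`. -/

/-- The expected loss of the set `A` for target `d` and independent Bernoulli responses. -/
noncomputable def expectedLoss {n : ℕ} (p : Fin n → ℝ) (d : ℝ) (A : Finset (Fin n)) : ℝ :=
  (∑ i ∈ A, p i - d) ^ 2 + ∑ i ∈ A, p i * (1 - p i)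

/-! ### Offline optimization of the expected loss -/

section Offline

variable {n : ℕ} {p : Fin n → ℝ} {d δ : ℝ}

/-- The variance term `p i (1 - p i)` combines with the square `p i ^ 2` from the bias into a term
linear in `p i`. This is why the threshold is `d - 1/2` and why the sign of the change does not
depend on which positive arm is added. -/
theorem expectedLoss_insert {A : Finset (Fin n)} {i : Fin n} (hi : i ∉ A) :
    expectedLoss p d (insert i A) =
      expectedLoss p d A + 2 * p i * (∑ j ∈ A, p j - (d - 1 / 2)) := by
  simp only [expectedLoss, Finset.sum_insert hi]
  ring

theorem expectedLoss_erase {A : Finset (Fin n)} {i : Fin n} (hi : i ∈ A) :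
    expectedLoss p d A =
      expectedLoss p d (A.erase i) + 2 * p i * (∑ j ∈ A.erase i, p j - (d - 1 / 2)) := by
  conv_lhs => rw [← Finset.insert_erase hi]
  exact expectedLoss_insert (Finset.notMem_erase i A)

/-- Among the minimizers of the expected loss there is one that is nested with a given set of
top arms and differs from it only in arms with positive parameters. -/
theorem exists_minimizer_nested (hp : ∀ i, 0 ≤ p i) (A : Finset (Fin n))
    (htop : ∀ i ∈ A, ∀ j ∉ A, p j ≤ p i) :
    ∃ B : Finset (Fin n), (∀ C, expectedLoss p d B ≤ expectedLoss p d C) ∧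
      (A ⊆ B ∨ B ⊆ A) ∧ (∀ i ∈ A \ B, 0 < p i) ∧ (∀ i ∈ B \ A, 0 < p i) := by
  classical
  obtain ⟨B₀, -, hB₀⟩ := Finset.exists_min_image (Finset.univ : Finset (Finset (Fin n)))
    (expectedLoss p d) Finset.univ_nonempty
  -- Among all minimizers, take one with the smallest symmetric difference from `A`; any
  -- loss-preserving move towards `A` is then contradictory.
  obtain ⟨B, hB, hmin⟩ := Finset.exists_min_image
    (Finset.univ.filter fun B => ∀ C, expectedLoss p d B ≤ expectedLoss p d C)
    (fun B => (A \ B).card + (B \ A).card) ⟨B₀, by simpa using hB₀⟩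
  simp only [Finset.mem_filter, Finset.mem_univ, true_and] at hB hmin
  have hadd : ∀ i ∈ A \ B, ∀ B', expectedLoss p d B' ≤ expectedLoss p d B →
      A \ B' ⊆ (A \ B).erase i → B' \ A ⊆ B \ A → False := by
    intro i hi B' hB' h1 h2
    have h := hmin B' fun C => hB'.trans (hB C)
    have h3 := Finset.card_le_card h1
    have h4 := Finset.card_le_card h2
    have h5 := Finset.card_erase_lt_of_mem hi
    omega
  have hrem : ∀ i ∈ B \ A, ∀ B', expectedLoss p d B' ≤ expectedLoss p d B →
      B' \ A ⊆ (B \ A).erase i → A \ B' ⊆ A \ B → False := by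
    intro i hi B' hB' h1 h2
    have h := hmin B' fun C => hB'.trans (hB C)
    have h3 := Finset.card_le_card h1
    have h4 := Finset.card_le_card h2
    have h5 := Finset.card_erase_lt_of_mem hi
    omega
  have hposA : ∀ i ∈ A \ B, 0 < p i := by
    intro i hi
    refine (hp i).lt_of_ne fun h0 => hadd i hi (insert i B) ?_ ?_ ?_
    · rw [expectedLoss_insert (Finset.mem_sdiff.1 hi).2, ← h0]; simp
    · intro j; simp only [Finset.mem_sdiff, Finset.mem_insert, Finset.mem_erase]; tauto
    · intro j; simp only [Finset.mem_sdiff, Finset.mem_insert] at hi ⊢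
      rintro ⟨rfl | h, h'⟩
      · exact absurd hi.1 h'
      · exact ⟨h, h'⟩
  have hposB : ∀ i ∈ B \ A, 0 < p i := by
    intro i hi
    refine (hp i).lt_of_ne fun h0 => hrem i hi (B.erase i) ?_ ?_ ?_
    · rw [expectedLoss_erase (Finset.mem_sdiff.1 hi).1, ← h0]; simp
    · intro j; simp only [Finset.mem_sdiff, Finset.mem_erase]; tauto
    · intro j; simp only [Finset.mem_sdiff, Finset.mem_erase] at hi ⊢
      rintro ⟨h, h'⟩
      refine ⟨h, fun hj => h' ⟨?_, hj⟩⟩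
      rintro rfl
      exact hi.2 h
  refine ⟨B, hB, ?_, hposA, hposB⟩
  by_contra hne
  rw [not_or, Finset.not_subset, Finset.not_subset] at hne
  obtain ⟨⟨i, hiA, hiB⟩, j, hjB, hjA⟩ := hne
  have hpj := hposB j (Finset.mem_sdiff.2 ⟨hjB, hjA⟩)
  have hij := htop i hiA j hjA
  have hiB' : i ∉ B.erase j := fun h => hiB (Finset.mem_of_mem_erase h)
  -- Exchange `j` for `i`: dropping `j` does not help, so the total without `j` is at most `d -
  -- 1/2`, and adding the larger `p i` instead of `p j` lowers the loss at least as much.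
  refine hadd i (Finset.mem_sdiff.2 ⟨hiA, hiB⟩) (insert i (B.erase j)) ?_ ?_ ?_
  · have h1 := hB (B.erase j)
    rw [expectedLoss_erase hjB] at h1
    rw [expectedLoss_insert hiB', expectedLoss_erase hjB]
    have h2 : ∑ l ∈ B.erase j, p l - (d - 1 / 2) ≤ 0 := by
      by_contra! h
      have := mul_pos (mul_pos two_pos hpj) h
      linarith
    nlinarith
  · intro l; simp only [Finset.mem_sdiff, Finset.mem_insert, Finset.mem_erase]
    rintro ⟨h1, h2⟩
    refine ⟨fun h => h2 (Or.inl h), h1, fun h => h2 (Or.inr ⟨?_, h⟩)⟩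
    rintro rfl
    exact hjA h1
  · intro l; simp only [Finset.mem_sdiff, Finset.mem_insert, Finset.mem_erase]
    rintro ⟨rfl | h, h'⟩
    · exact absurd hiA h'
    · exact ⟨h.2, h'⟩

/-- A set of top arms whose total is, up to `δ`, just above `d - 1/2`, is optimal up to `2 δ`. -/
theorem expectedLoss_le_of_nearly_critical (hp : ∀ i, 0 ≤ p i ∧ p i ≤ 1) (hδ : 0 ≤ δ)
    (hδp : ∀ i, 0 < p i → δ < p i) {A : Finset (Fin n)}
    (htop : ∀ i ∈ A, ∀ j ∉ A, p j ≤ p i)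
    (hlow : A = Finset.univ ∨ d - 1 / 2 - δ ≤ ∑ i ∈ A, p i)
    (hup : A = ∅ ∨ ∃ l ∈ A, (∀ i ∈ A, p l ≤ p i) ∧ ∑ i ∈ A.erase l, p i ≤ d - 1 / 2 + δ)
    (B : Finset (Fin n)) :
    expectedLoss p d A ≤ expectedLoss p d B + 2 * δ := by
  obtain ⟨B', hB', hnest, hposA, hposB⟩ :=
    exists_minimizer_nested (d := d) (fun i => (hp i).1) A htop
  refine le_trans ?_ (add_le_add_left (hB' B) _)
  rcases eq_or_ne A B' with rfl | hne
  · linarith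
  rcases hnest with hAB | hBA
  · obtain ⟨j, hjB, hjA⟩ := Finset.exists_of_ssubset (hAB.ssubset_of_ne hne)
    have hpj := hposB j (Finset.mem_sdiff.2 ⟨hjB, hjA⟩)
    have hlow : d - 1 / 2 - δ ≤ ∑ i ∈ A, p i := by
      rcases hlow with h | h
      · exact absurd (h ▸ Finset.mem_univ j) hjA
      · exact h
    have h1 := hB' (B'.erase j)
    rw [expectedLoss_erase hjB] at h1
    have h2 : ∑ l ∈ B'.erase j, p l ≤ d - 1 / 2 := by
      by_contra! h
      have := mul_pos (mul_pos two_pos hpj) (sub_pos.2 h)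
      linarith
    have hsub : A ⊆ B'.erase j := fun i hi => Finset.mem_erase.2
      ⟨fun h => hjA (h ▸ hi), hAB hi⟩
    -- A second extra arm would have a parameter above `δ` and push the total of `A` below `d - 1/2
    -- - δ`. So `B'` has just one arm more, whose effect on the loss is at least `-2 δ`.
    have hEq : A = B'.erase j := by
      by_contra hne'
      obtain ⟨k, hkB, hkA⟩ := Finset.exists_of_ssubset (hsub.ssubset_of_ne hne')
      have hpk := hposB k (Finset.mem_sdiff.2 ⟨Finset.mem_of_mem_erase hkB, hkA⟩)
      have h3 : ∑ l ∈ insert k A, p l ≤ ∑ l ∈ B'.erase j, p l :=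
        Finset.sum_le_sum_of_subset_of_nonneg
          (Finset.insert_subset hkB hsub) fun i _ _ => (hp i).1
      rw [Finset.sum_insert hkA] at h3
      linarith [hδp k hpk]
    rw [expectedLoss_erase hjB, ← hEq]
    nlinarith [(hp j).2]
  · obtain ⟨i, hiA, hiB⟩ := Finset.exists_of_ssubset (hBA.ssubset_of_ne (Ne.symm hne))
    have hpi := hposA i (Finset.mem_sdiff.2 ⟨hiA, hiB⟩)
    obtain ⟨l, hlA, hl, hup⟩ := hup.resolve_left (Finset.ne_empty_of_mem hiA)
    have h1 := hB' (insert i B')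
    rw [expectedLoss_insert hiB] at h1
    have h2 : d - 1 / 2 ≤ ∑ l ∈ B', p l := by
      by_contra! h
      have := mul_pos (mul_pos two_pos hpi) (sub_pos.2 h)
      linarith
    have hsub : B' ⊆ A.erase i := fun j hj => Finset.mem_erase.2
      ⟨fun h => hiB (h ▸ hj), hBA hj⟩
    -- The hypothesis concerns the smallest arm `l` of `A`; removing `i` instead leaves no larger
    -- total.
    have h3 : ∑ j ∈ A.erase i, p j ≤ d - 1 / 2 + δ := by
      have h4 := Finset.add_sum_erase A p hiA
      have h5 := Finset.add_sum_erase A p hlA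
      linarith [hl i hiA]
    have hEq : B' = A.erase i := by
      by_contra hne'
      obtain ⟨k, hkA, hkB⟩ := Finset.exists_of_ssubset (hsub.ssubset_of_ne hne')
      have hpk := hposA k (Finset.mem_sdiff.2 ⟨Finset.mem_of_mem_erase hkA, hkB⟩)
      have h3 : ∑ l ∈ insert k B', p l ≤ ∑ l ∈ A.erase i, p l :=
        Finset.sum_le_sum_of_subset_of_nonneg
          (Finset.insert_subset hkA hsub) fun i _ _ => (hp i).1
      rw [Finset.sum_insert hkB] at h3
      linarith [hδp k hpk]
    rw [expectedLoss_erase hiA, hEq]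
    nlinarith [(hp i).2]

end Offline

/-! ### The gap constants and the exploration threshold -/

section Constants

variable {n : ℕ} {p : Fin n → ℝ}

theorem deltaMin_le_of_lt {i j : Fin n} (hij : p i < p j) :
    deltaMin p ≤ ENNReal.ofReal (p j - p i) := by
  have hanti : ∀ a b, a ≤ b → p (ranking p b) ≤ p (ranking p a) := by
    intro a b hab
    exact neg_le_neg_iff.1 (Tuple.monotone_sort (fun i => -p i) hab)
  set a := (ranking p).symm j with ha
  -- Walk up the ranking from `b` towards `a`: at the first strict increase a consecutive positive
  -- gap appears, and it is at most the whole difference.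
  have key : ∀ m : ℕ, ∀ b : Fin n, (b : ℕ) = a + m → p (ranking p b) < p j →
      deltaMin p ≤ ENNReal.ofReal (p j - p (ranking p b)) := by
    intro m
    induction m with
    | zero =>
      intro b hb hlt
      have : b = a := Fin.ext (by simpa using hb)
      simp [this, ha] at hlt
    | succ m ih =>
      intro b hb hlt
      let c : Fin n := ⟨a + m, by omega⟩
      have hcb : p (ranking p b) ≤ p (ranking p c) := hanti c b (by simp [Fin.le_def, c]; omega)
      have hac : p (ranking p c) ≤ p j := by
        have := hanti a c (by simp [Fin.le_def, c])
        simpa [ha] using this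
      rcases hcb.lt_or_eq with h | h
      · have h1 : deltaMin p ≤ ENNReal.ofReal (p (ranking p c) - p (ranking p b)) := by
          unfold deltaMin
          exact iInf₂_le_of_le c b (iInf₂_le_of_le (by simp [c]; omega) (sub_pos.2 h) le_rfl)
        exact h1.trans (ENNReal.ofReal_le_ofReal (by linarith))
      · rw [h]
        exact ih c rfl (h ▸ hlt)
  have hab : a ≤ (ranking p).symm i := by
    by_contra! h
    have := hanti _ _ h.le
    simp [ha] at this
    linarith
  have := key (((ranking p).symm i : ℕ) - a) ((ranking p).symm i)
    (by have : (a : ℕ) ≤ ((ranking p).symm i : ℕ) := hab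
        omega) (by simpa using hij)
  simpa using this

theorem two_mul_lt_gap {r : ℝ} (hr : ENNReal.ofReal r < eps1 p) {i j : Fin n} (hij : p i < p j) :
    2 * r < p j - p i := by
  have h1 : ENNReal.ofReal r < deltaMin p / 2 := hr.trans_le (min_le_left _ _)
  have h2 := ENNReal.mul_lt_of_lt_div h1
  have h3 := h2.trans_le (deltaMin_le_of_lt hij)
  rw [show (2 : ℝ≥0∞) = ENNReal.ofReal 2 by simp, mul_comm,
    ← ENNReal.ofReal_mul (by norm_num)] at h3
  exact (ENNReal.ofReal_lt_ofReal_iff (sub_pos.2 hij)).1 h3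

theorem nat_mul_lt_of_pos {r : ℝ} (hr : ENNReal.ofReal r < eps1 p) {i : Fin n} (hi : 0 < p i) :
    n * r < p i := by
  have h1 : ENNReal.ofReal r < betaMin p / n := hr.trans_le (min_le_right _ _)
  have h2 := ENNReal.mul_lt_of_lt_div h1
  have h3 : ENNReal.ofReal r * n < ENNReal.ofReal (p i) :=
    h2.trans_le (iInf₂_le_of_le i hi le_rfl)
  rw [show (n : ℝ≥0∞) = ENNReal.ofReal n by simp, mul_comm,
    ← ENNReal.ofReal_mul (by positivity)] at h3
  exact (ENNReal.ofReal_lt_ofReal_iff hi).1 h3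

theorem eps1_pos : 0 < eps1 p := by
  have hd : deltaMin p ≠ 0 := by
    have : ∀ g : Fin n × Fin n → ℝ, ∃ c > 0, ∀ x, 0 < g x → c ≤ g x := by
      intro g
      obtain h | h := (Finset.univ.filter fun x => 0 < g x).eq_empty_or_nonempty
      · refine ⟨1, one_pos, fun x hx => ?_⟩
        have : x ∈ (Finset.univ.filter fun x => 0 < g x) := by simpa using hx
        simp [h] at this
      · obtain ⟨y, hy, hmin⟩ := Finset.exists_min_image _ g h
        exact ⟨g y, by simpa using hy, fun x hx => hmin x (by simpa using hx)⟩
    obtain ⟨c, hc, h⟩ := this fun x => p (ranking p x.1) - p (ranking p x.2)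
    have : ENNReal.ofReal c ≤ deltaMin p :=
      le_iInf₂ fun j k => le_iInf₂ fun _ hjk => ENNReal.ofReal_le_ofReal (h (j, k) hjk)
    exact (lt_of_lt_of_le (ENNReal.ofReal_pos.2 hc) this).ne'
  have hb : betaMin p ≠ 0 := by
    have : ∃ c > 0, ∀ x, 0 < p x → c ≤ p x := by
      obtain h | h := (Finset.univ.filter fun x => 0 < p x).eq_empty_or_nonempty
      · refine ⟨1, one_pos, fun x hx => ?_⟩
        have : x ∈ (Finset.univ.filter fun x => 0 < p x) := by simpa using hx
        simp [h] at this
      · obtain ⟨y, hy, hmin⟩ := Finset.exists_min_image _ p h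
        exact ⟨p y, by simpa using hy, fun x hx => hmin x (by simpa using hx)⟩
    obtain ⟨c, hc, h⟩ := this
    have : ENNReal.ofReal c ≤ betaMin p :=
      le_iInf₂ fun j hj => ENNReal.ofReal_le_ofReal (h j hj)
    exact (lt_of_lt_of_le (ENNReal.ofReal_pos.2 hc) this).ne'
  exact lt_min (ENNReal.div_pos hd (by simp)) (ENNReal.div_pos hb (by simp))

/-- The formula survives `eps1 p = ⊤`: then `toReal` is `0` and division by zero yields the intended
value `0`. -/
theorem explorationTerm_eq (α : ℝ) (hα : 0 ≤ α) (T : ℕ) :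
    explorationTerm p α T = α * Real.log T / (2 * (eps1 p).toReal ^ 2) := by
  rw [explorationTerm, ENNReal.toReal_div, ENNReal.toReal_ofReal
    (mul_nonneg hα (Real.log_natCast_nonneg T))]
  simp

/-- Solving `ε₁ ≤ radius` for the selection count: an arm with a large radius has been selected only
logarithmically often. -/
theorem le_explorationTerm {α : ℝ} (hα : 0 ≤ α) {t T m : ℕ} (ht : 1 ≤ t) (htT : t ≤ T)
    (hm : m ≠ 0) (h : eps1 p ≤ ENNReal.ofReal √(α * Real.log t / (2 * (m : ℝ)))) :
    (m : ℝ) ≤ explorationTerm p α T := by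
  have hne : eps1 p ≠ ⊤ := ne_top_of_le_ne_top ENNReal.ofReal_ne_top h
  have hpos : 0 < (eps1 p).toReal := ENNReal.toReal_pos eps1_pos.ne' hne
  have h1 : (eps1 p).toReal ≤ √(α * Real.log t / (2 * (m : ℝ))) :=
    ENNReal.toReal_le_of_le_ofReal (Real.sqrt_nonneg _) h
  have hm' : (0 : ℝ) < m := by positivity
  have hlog : Real.log t ≤ Real.log T :=
    Real.log_le_log (by exact_mod_cast ht) (by exact_mod_cast htT)
  have h2 : (eps1 p).toReal ^ 2 ≤ α * Real.log t / (2 * (m : ℝ)) := by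
    rw [← Real.sq_sqrt (div_nonneg (mul_nonneg hα (Real.log_natCast_nonneg t))
      (by positivity : (0 : ℝ) ≤ 2 * m))]
    gcongr
  rw [explorationTerm_eq α hα, le_div_iff₀ (by positivity)]
  rw [le_div_iff₀ (by positivity)] at h2
  nlinarith [mul_le_mul_of_nonneg_left hlog hα]

end Constants

end DemandResponse

namespace DemandResponse

/-! ### Near-optimality of a selection from accurate estimates -/

section Selection

variable {n : ℕ} {p : Fin n → ℝ}

/-- A selection from accurate estimates, in which all selected arms have a confidence radius below
`ε₁`, is optimal up to twice the sum of the confidence radii of its arms. -/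
theorem expectedLoss_le_of_isSelection (hp : ∀ i, 0 ≤ p i ∧ p i ≤ 1) {d : ℝ} {q r : Fin n → ℝ}
    {A : Finset (Fin n)} (hr : ∀ i, 0 ≤ r i) (hq : ∀ i, |q i - p i| ≤ r i)
    (hA : IsSelection (fun i => min (q i + r i) 1) q d A)
    (hε : ∀ i ∈ A, ENNReal.ofReal (r i) < eps1 p) (B : Finset (Fin n)) :
    expectedLoss p d A ≤ expectedLoss p d B + ∑ i ∈ A, 2 * r i := by
  obtain ⟨σ, hσ, k, hk, rfl⟩ := hA
  have hkn : k ≤ n := by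
    rcases hk with h | h
    · exact h.1.1
    · exact h.2.le
  have hmem : ∀ m i, i ∈ topSet σ m ↔ (σ.symm i : ℕ) < m := fun m i => by simp [topSet]
  have hsum : ∀ C : Finset (Fin n), |∑ i ∈ C, q i - ∑ i ∈ C, p i| ≤ ∑ i ∈ C, r i := by
    intro C
    rw [← Finset.sum_sub_distrib]
    exact (Finset.abs_sum_le_sum_abs _ _).trans (Finset.sum_le_sum fun i _ => hq i)
  -- Optimism: `p j ≤ U j ≤ U i ≤ p i + 2 r i`, and `2 r i` is smaller than any positive gap. The
  -- radius of `j` plays no role, and truncation at `1` is harmless because `p j ≤ 1`.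
  have horder : ∀ i ∈ topSet σ k, ∀ j, σ.symm i ≤ σ.symm j → p j ≤ p i := by
    intro i hi j hij
    by_contra! hlt
    have h1 := two_mul_lt_gap (hε i hi) hlt
    have h2 : min (q j + r j) 1 ≤ min (q i + r i) 1 := by simpa using hσ hij
    have h3 : p j ≤ min (q j + r j) 1 :=
      le_min (by linarith [(abs_le.1 (hq j)).1]) (hp j).2
    have h4 := (h3.trans h2).trans (min_le_left _ _)
    linarith [(abs_le.1 (hq i)).2]
  rw [← Finset.mul_sum]
  refine expectedLoss_le_of_nearly_critical hp (Finset.sum_nonneg fun i _ => hr i) ?_ ?_ ?_ ?_ B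
  -- At most `n` radii are summed, each below `p i / n`; this is the purpose of `β_min / n` in `ε₁`.
  · intro i hi
    have hn : (0 : ℝ) < n := by exact_mod_cast i.pos
    rcases (topSet σ k).eq_empty_or_nonempty with h | h
    · simpa [h] using hi
    · refine lt_of_mul_lt_mul_left ?_ hn.le
      rw [Finset.mul_sum]
      calc ∑ j ∈ topSet σ k, n * r j < ∑ j ∈ topSet σ k, p i :=
            Finset.sum_lt_sum_of_nonempty h fun j hj => nat_mul_lt_of_pos (hε j hj) hi
        _ ≤ n * p i := by
            rw [Finset.sum_const, nsmul_eq_mul]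
            gcongr
            simpa using Finset.card_le_univ (topSet σ k)
  · intro i hi j hj
    rw [hmem] at hi hj
    exact horder i ((hmem _ _).2 hi) j (Fin.le_def.2 (by omega))
  · rcases hk with h | h
    · right
      have := h.1.2
      linarith [(abs_le.1 (hsum (topSet σ k))).2]
    · left
      ext i
      simp [hmem, h.2]
  · rcases Nat.eq_zero_or_pos k with rfl | hk0
    · left
      ext i
      simp [hmem]
    · right
      let l : Fin n := ⟨k - 1, by omega⟩
      have hl : σ l ∈ topSet σ k := by rw [hmem]; simp [l]; omega
      have her : (topSet σ k).erase (σ l) = topSet σ (k - 1) := by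
        ext i
        rw [Finset.mem_erase, hmem, hmem]
        constructor
        · rintro ⟨h1, h2⟩
          by_contra h3
          apply h1
          rw [← Equiv.symm_apply_eq]
          exact Fin.ext (by simp [l]; omega)
        · intro h
          refine ⟨?_, by omega⟩
          rintro rfl
          simp [l] at h
      refine ⟨σ l, hl, fun i hi => horder i hi _ ?_, ?_⟩
      · rw [hmem] at hi
        rw [Fin.le_def]; simp [l]; omega
      · have h1 : ∑ i ∈ topSet σ (k - 1), q i ≤ d - 1 / 2 := by
          rcases hk with h | h
          · by_contra! hc
            have := h.2 ⟨(by omega : k - 1 ≤ n), hc⟩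
            omega
          · exact h.1 _ (by omega)
        have h2 : ∑ i ∈ topSet σ (k - 1), r i ≤ ∑ i ∈ topSet σ k, r i :=
          Finset.sum_le_sum_of_subset_of_nonneg (her ▸ Finset.erase_subset _ _)
            fun i _ _ => hr i
        rw [her]
        linarith [(abs_le.1 (hsum (topSet σ (k - 1)))).1]

end Selection

/-! ### Selection counts and summation of the charges -/

section Counting

variable {n : ℕ} (s : ℕ → Finset (Fin n)) (i : Fin n)

theorem pullTimes_zero : pullTimes s i 0 = ∅ := by
  simp [pullTimes]

theorem pulls_zero : pulls s i 0 = 0 := by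
  simp [pulls, pullTimes_zero]

theorem pullTimes_succ (t : ℕ) :
    pullTimes s i (t + 1) =
      if i ∈ s (t + 1) then insert (t + 1) (pullTimes s i t) else pullTimes s i t := by
  rw [pullTimes, ← Finset.insert_Icc_right_eq_Icc_add_one (by omega), Finset.filter_insert,
    pullTimes]

theorem sum_pullTimes_succ (f : ℕ → ℝ) (t : ℕ) :
    ∑ τ ∈ pullTimes s i (t + 1), f τ =
      ∑ τ ∈ pullTimes s i t, f τ + if i ∈ s (t + 1) then f (t + 1) else 0 := by
  rw [pullTimes_succ]
  split_ifs
  · rw [Finset.sum_insert (by simp [pullTimes]), add_comm]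
  · simp

theorem pulls_succ (t : ℕ) :
    pulls s i (t + 1) = pulls s i t + if i ∈ s (t + 1) then 1 else 0 := by
  rw [pulls, pullTimes_succ]
  split_ifs
  · rw [Finset.card_insert_of_notMem (by simp [pullTimes]), pulls]
  · simp [pulls]

theorem pulls_le (t : ℕ) : pulls s i t ≤ t := by
  have := Finset.card_filter_le (Finset.Icc 1 t) (fun τ => i ∈ s τ)
  simpa [pulls, pullTimes] using this

/-- Successive selections of an arm see the selection counts `0, 1, 2, …`. -/
theorem sum_pullTimes_pulls (g : ℕ → ℝ) (T : ℕ) :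
    ∑ t ∈ pullTimes s i T, g (pulls s i (t - 1)) = ∑ m ∈ Finset.range (pulls s i T), g m := by
  induction T with
  | zero => simp [pullTimes_zero, pulls_zero]
  | succ T ih =>
    rw [sum_pullTimes_succ, ih, pulls_succ]
    split_ifs
    · simp [Finset.sum_range_succ]
    · simp

theorem sum_range_inv_sqrt_le (m : ℕ) :
    ∑ k ∈ Finset.range m, 1 / √(k : ℝ) ≤ 2 * √(m : ℝ) := by
  -- The term `k = 0` is `1 / 0 = 0`, so one more term fits under the same bound, and the induction
  -- compares `1 / √(m + 1)` with `2 (√(m + 1) - √m)`.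
  have key : ∑ k ∈ Finset.range (m + 1), 1 / √(k : ℝ) ≤ 2 * √(m : ℝ) := by
    induction m with
    | zero => simp
    | succ m ih =>
      rw [Finset.sum_range_succ]
      have h0 : (0 : ℝ) < √((m + 1 : ℕ) : ℝ) := Real.sqrt_pos.2 (by positivity)
      have h1 := Real.sq_sqrt (Nat.cast_nonneg (α := ℝ) (m + 1))
      have h2 := Real.sq_sqrt (Nat.cast_nonneg (α := ℝ) m)
      have h3 : 1 / √((m + 1 : ℕ) : ℝ) ≤ 2 * (√((m + 1 : ℕ) : ℝ) - √(m : ℝ)) := by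
        rw [div_le_iff₀ h0]
        push_cast at h1 ⊢
        nlinarith [sq_nonneg (√((m : ℝ) + 1) - √(m : ℝ))]
      linarith
  refine le_trans ?_ key
  rw [Finset.sum_range_succ]
  exact le_add_of_nonneg_right (by positivity)

/-- The cost charged to a selection of an arm that has been selected `m` times before: `M` in the
initialization and as long as `m ≤ N`, and a cost proportional to the confidence radius. -/
noncomputable def selectionCost (M N c : ℝ) (m : ℕ) : ℝ :=
  M * (if m = 0 then 1 else 0) + M * (if 1 ≤ m ∧ (m : ℝ) ≤ N then 1 else 0) + c * (1 / √(m : ℝ))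

theorem selectionCost_nonneg {M N c : ℝ} (hM : 0 ≤ M) (hc : 0 ≤ c) (m : ℕ) :
    0 ≤ selectionCost M N c m := by
  unfold selectionCost
  have h1 : (0 : ℝ) ≤ if m = 0 then 1 else 0 := by split_ifs <;> norm_num
  have h2 : (0 : ℝ) ≤ if 1 ≤ m ∧ (m : ℝ) ≤ N then 1 else 0 := by split_ifs <;> norm_num
  positivity

theorem sum_range_selectionCost_le {M N c : ℝ} (hM : 0 ≤ M) (hN : 0 ≤ N) (hc : 0 ≤ c) (K : ℕ) :
    ∑ m ∈ Finset.range K, selectionCost M N c m ≤ M + M * N + c * (2 * √(K : ℝ)) := by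
  unfold selectionCost
  rw [Finset.sum_add_distrib, Finset.sum_add_distrib, ← Finset.mul_sum, ← Finset.mul_sum,
    ← Finset.mul_sum]
  have h1 : ∑ m ∈ Finset.range K, (if m = 0 then (1 : ℝ) else 0) ≤ 1 := by
    rw [Finset.sum_ite_eq']
    split_ifs <;> norm_num
  have h2 : ∑ m ∈ Finset.range K, (if 1 ≤ m ∧ (m : ℝ) ≤ N then (1 : ℝ) else 0) ≤ N := by
    rw [Finset.sum_boole]
    have hsub : (Finset.range K).filter (fun m : ℕ => 1 ≤ m ∧ (m : ℝ) ≤ N) ⊆ Finset.Icc 1 ⌊N⌋₊ := by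
      intro m
      simp only [Finset.mem_filter, Finset.mem_Icc]
      exact fun h => ⟨h.2.1, Nat.le_floor h.2.2⟩
    have := Finset.card_le_card hsub
    rw [Nat.card_Icc, Nat.add_sub_cancel] at this
    exact (Nat.cast_le.2 this).trans (Nat.floor_le hN)
  have h3 := sum_range_inv_sqrt_le K
  have h4 := mul_le_mul_of_nonneg_left h1 hM
  have h5 := mul_le_mul_of_nonneg_left h2 hM
  have h6 := mul_le_mul_of_nonneg_left h3 hc
  linarith

/-- Exchanging the sums over times and arms turns the charges of one arm into a sum over consecutive
counts, of which there are at most `T`. -/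
theorem sum_selectionCost_le {M N c : ℝ} (hM : 0 ≤ M) (hN : 0 ≤ N) (hc : 0 ≤ c) (T : ℕ) :
    ∑ t ∈ Finset.Icc 1 T, ∑ i ∈ s t, selectionCost M N c (pulls s i (t - 1)) ≤
      n * (M + M * N + c * (2 * √(T : ℝ))) := by
  have h : ∑ t ∈ Finset.Icc 1 T, ∑ i ∈ s t, selectionCost M N c (pulls s i (t - 1)) =
      ∑ i, ∑ t ∈ pullTimes s i T, selectionCost M N c (pulls s i (t - 1)) := by
    refine Finset.sum_comm' fun t i => ?_
    simp [pullTimes]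
  rw [h]
  calc _ ≤ ∑ i : Fin n, (M + M * N + c * (2 * √(T : ℝ))) := by
        refine Finset.sum_le_sum fun i _ => ?_
        rw [sum_pullTimes_pulls]
        refine (sum_range_selectionCost_le hM hN hc _).trans ?_
        have : (pulls s i T : ℝ) ≤ T := by exact_mod_cast pulls_le s i T
        gcongr
    _ = _ := by rw [Finset.sum_const, Finset.card_fin, nsmul_eq_mul]

end Counting

/-! ### Charging one step to its selected arms -/

section Step

variable {n : ℕ} {p : Fin n → ℝ}

/-- The confidence radius at time `t` of an arm that has been selected `m` times. -/
noncomputable def confidenceRadius (α : ℝ) (t m : ℕ) : ℝ :=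
  √(α * Real.log t / (2 * (m : ℝ)))

/-- The excess expected loss of a step of CUCB-Avg with accurate sample averages is covered by the
costs of its selections. -/
theorem expectedLoss_step_le (hp : ∀ i, 0 ≤ p i ∧ p i ≤ 1) {α d M : ℝ} (hα : 0 ≤ α)
    {s : ℕ → Finset (Fin n)} {x : ℕ → Fin n → ℝ} {t T : ℕ} (ht : 1 ≤ t) (htT : t ≤ T)
    (hstep : CUCBAvgStep α d s x t) {B : Finset (Fin n)} (hM : 0 ≤ M)
    (hMB : expectedLoss p d (s t) - expectedLoss p d B ≤ M)
    (hgood : ∀ i, pulls s i (t - 1) ≠ 0 →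
      |sampleMean s x i (t - 1) - p i| ≤ confidenceRadius α t (pulls s i (t - 1))) :
    expectedLoss p d (s t) - expectedLoss p d B ≤
      ∑ i ∈ s t, selectionCost M (explorationTerm p α T) √(2 * α * Real.log T)
        (pulls s i (t - 1)) := by
  have hc : 0 ≤ √(2 * α * Real.log T) := Real.sqrt_nonneg _
  have hnn := fun i => selectionCost_nonneg (N := explorationTerm p α T) hM hc (pulls s i (t - 1))
  have hpart : ∀ i, 0 ≤ √(2 * α * Real.log T) * (1 / √((pulls s i (t - 1) : ℕ) : ℝ)) :=
    fun i => by positivity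
  by_cases hinit : ∃ i, pulls s i (t - 1) = 0
  -- Initialization: the newly selected arm alone pays the maximal loss `M`.
  · obtain ⟨i, hi, hi0⟩ := hstep.1 hinit
    refine hMB.trans (le_trans ?_ (Finset.single_le_sum (fun j _ => hnn j) hi))
    simp [selectionCost, hi0]
  · push Not at hinit
    by_cases hexp : ∀ i ∈ s t,
        ENNReal.ofReal (confidenceRadius α t (pulls s i (t - 1))) < eps1 p
    · have h := expectedLoss_le_of_isSelection hp
        (r := fun i => confidenceRadius α t (pulls s i (t - 1)))
        (fun i => Real.sqrt_nonneg _) (fun i => hgood i (hinit i)) (hstep.2 hinit) hexp B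
      rw [sub_le_iff_le_add']
      refine h.trans (add_le_add_right (Finset.sum_le_sum fun i _ => ?_) _)
      have h1 : 2 * confidenceRadius α t (pulls s i (t - 1)) ≤
          √(2 * α * Real.log T) * (1 / √((pulls s i (t - 1) : ℕ) : ℝ)) := by
        have hm : (0 : ℝ) < pulls s i (t - 1) := by exact_mod_cast Nat.pos_of_ne_zero (hinit i)
        have hlog : Real.log t ≤ Real.log T :=
          Real.log_le_log (by exact_mod_cast ht) (by exact_mod_cast htT)
        have h4 : (2 : ℝ) = √(2 ^ 2) := by rw [Real.sqrt_sq (by norm_num)]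
        rw [mul_one_div, ← Real.sqrt_div' _ hm.le, confidenceRadius]
        nth_rewrite 1 [h4]
        rw [← Real.sqrt_mul (by norm_num)]
        apply Real.sqrt_le_sqrt
        rw [show (2 : ℝ) ^ 2 * (α * Real.log t / (2 * (pulls s i (t - 1) : ℝ))) =
          2 * α * Real.log t / (pulls s i (t - 1) : ℝ) by field_simp]
        gcongr
      refine h1.trans ?_
      unfold selectionCost
      refine le_add_of_nonneg_left ?_
      have h1 : (0 : ℝ) ≤ if pulls s i (t - 1) = 0 then 1 else 0 := by split_ifs <;> norm_num
      have h2 : (0 : ℝ) ≤ if 1 ≤ pulls s i (t - 1) ∧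
        (pulls s i (t - 1) : ℝ) ≤ explorationTerm p α T then 1 else 0 := by
        split_ifs <;> norm_num
      positivity
    -- Some selected arm still has a radius of at least `ε₁`; its count is at most the exploration
    -- term, so it pays `M`.
    · push Not at hexp
      obtain ⟨i, hi, hle⟩ := hexp
      refine hMB.trans (le_trans ?_ (Finset.single_le_sum (fun j _ => hnn j) hi))
      have h := le_explorationTerm hα ht htT (hinit i) hle
      have h1 : 1 ≤ pulls s i (t - 1) := Nat.pos_of_ne_zero (hinit i)
      unfold selectionCost
      rw [if_neg (hinit i), if_pos ⟨h1, h⟩]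
      linarith [hpart i]

end Step

end DemandResponse

namespace DemandResponse

/-! ### Exponential weights dominating the failure event -/

section Weights

variable {n : ℕ} {Ω : Type*} {p : Fin n → ℝ} {X : ℕ → Fin n → Ω → ℝ} {S : ℕ → Ω → Finset (Fin n)}

theorem measurableSet_mem_selection {m : MeasurableSpace Ω} {R : Ω → Finset (Fin n)}
    (hR : ∀ A : Finset (Fin n), MeasurableSet[m] {ω | R ω = A}) (i : Fin n) :
    MeasurableSet[m] {ω | i ∈ R ω} := by
  have : {ω | i ∈ R ω} = ⋃ A ∈ Finset.univ.filter (fun A : Finset (Fin n) => i ∈ A),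
      {ω | R ω = A} := by
    ext ω
    simp
  rw [this]
  exact Finset.measurableSet_biUnion _ fun A _ => hR A

/-- The exponential supermartingale of the deviations of the responses of arm `i` from `q`. -/
noncomputable def deviationWeight (X : ℕ → Fin n → Ω → ℝ) (S : ℕ → Ω → Finset (Fin n)) (i : Fin n)
    (q l : ℝ) (t : ℕ) (ω : Ω) : ℝ :=
  Real.exp (∑ τ ∈ pullTimes (fun τ => S τ ω) i t, (l * (X τ i ω - q) - l ^ 2 / 8))

theorem deviationWeight_succ (i : Fin n) (q l : ℝ) (t : ℕ) (ω : Ω) :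
    deviationWeight X S i q l (t + 1) ω = deviationWeight X S i q l t ω *
      if i ∈ S (t + 1) ω then Real.exp (l * (X (t + 1) i ω - q) - l ^ 2 / 8) else 1 := by
  rw [deviationWeight, sum_pullTimes_succ, Real.exp_add, deviationWeight]
  split_ifs <;> simp

theorem deviationWeight_pos (i : Fin n) (q l : ℝ) (t : ℕ) (ω : Ω) :
    0 < deviationWeight X S i q l t ω :=
  Real.exp_pos _

/-- A bound on the indicator of the event that some confidence interval at time `t` fails. -/
noncomputable def failureBound (α : ℝ) (p : Fin n → ℝ) (X : ℕ → Fin n → Ω → ℝ)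
    (S : ℕ → Ω → Finset (Fin n)) (t : ℕ) (ω : Ω) : ℝ :=
  ∑ i : Fin n, ∑ m ∈ Finset.Icc 1 (t - 1), (t : ℝ) ^ (-α) *
    (deviationWeight X S i (p i) (4 * confidenceRadius α t m) (t - 1) ω +
      deviationWeight X S i (p i) (-(4 * confidenceRadius α t m)) (t - 1) ω)

theorem failureBound_nonneg (α : ℝ) (t : ℕ) (ω : Ω) : 0 ≤ failureBound α p X S t ω := by
  refine Finset.sum_nonneg fun i _ => Finset.sum_nonneg fun m _ => ?_
  unfold deviationWeight
  positivity

theorem one_le_failureBound {α : ℝ} (hα : 0 ≤ α) {t : ℕ} (ht : 1 ≤ t) {ω : Ω}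
    (h : ∃ i, pulls (fun τ => S τ ω) i (t - 1) ≠ 0 ∧
      confidenceRadius α t (pulls (fun τ => S τ ω) i (t - 1)) <
        |sampleMean (fun τ => S τ ω) (fun τ i => X τ i ω) i (t - 1) - p i|) :
    1 ≤ failureBound α p X S t ω := by
  obtain ⟨i, hm, hr⟩ := h
  set m := pulls (fun τ => S τ ω) i (t - 1) with hmdef
  set r := confidenceRadius α t m with hrdef
  have hW : ∀ i l, 0 < deviationWeight X S i (p i) l (t - 1) ω := fun i l => Real.exp_pos _
  have hnn : ∀ i, ∀ m : ℕ, 0 ≤ (t : ℝ) ^ (-α) *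
    (deviationWeight X S i (p i) (4 * confidenceRadius α t m) (t - 1) ω +
      deviationWeight X S i (p i) (-(4 * confidenceRadius α t m)) (t - 1) ω) := fun i m =>
    mul_nonneg (by positivity) (add_pos (hW _ _) (hW _ _)).le
  have hmI : m ∈ Finset.Icc 1 (t - 1) :=
    Finset.mem_Icc.2 ⟨Nat.pos_of_ne_zero hm, pulls_le _ _ _⟩
  refine le_trans ?_ (Finset.single_le_sum
    (fun j _ => Finset.sum_nonneg fun m _ => hnn j m) (Finset.mem_univ i))
  refine le_trans ?_ (Finset.single_le_sum (fun m _ => hnn i m) hmI)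
  have ht0 : (0 : ℝ) < t := by exact_mod_cast ht
  have hm0 : (0 : ℝ) < m := by exact_mod_cast Nat.pos_of_ne_zero hm
  have hr0 : 0 ≤ r := Real.sqrt_nonneg _
  have hr2 : 2 * m * r ^ 2 = α * Real.log t := by
    rw [hrdef, confidenceRadius, Real.sq_sqrt (div_nonneg
      (mul_nonneg hα (Real.log_natCast_nonneg t)) (by positivity))]
    field_simp
  have hexp : ∀ l, deviationWeight X S i (p i) l (t - 1) ω = Real.exp
      (m * (l * (sampleMean (fun τ => S τ ω) (fun τ i => X τ i ω) i (t - 1) - p i)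
        - l ^ 2 / 8)) := by
    intro l
    have hs : ∑ τ ∈ pullTimes (fun τ => S τ ω) i (t - 1), X τ i ω =
        m * sampleMean (fun τ => S τ ω) (fun τ i => X τ i ω) i (t - 1) := by
      rw [sampleMean, ← hmdef, mul_div_cancel₀ _ hm0.ne']
    have hc : ((pullTimes (fun τ => S τ ω) i (t - 1)).card : ℝ) = m := rfl
    rw [deviationWeight]
    congr 1
    rw [Finset.sum_sub_distrib, ← Finset.mul_sum, Finset.sum_sub_distrib, hs, Finset.sum_const,
      Finset.sum_const, nsmul_eq_mul, nsmul_eq_mul, hc]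
    ring
  -- The choice `l = 4 r` maximizes `l r - l ^ 2 / 8`, with value `2 r ^ 2`; multiplied by `m` this
  -- is `α log t`. The two signs of `l` cover the two directions of deviation.
  have hmain : (t : ℝ) ^ α ≤ deviationWeight X S i (p i) (4 * r) (t - 1) ω +
      deviationWeight X S i (p i) (-(4 * r)) (t - 1) ω := by
    rw [Real.rpow_def_of_pos ht0, mul_comm (Real.log t), ← hr2]
    rcases lt_abs.1 hr with h | h
    · refine le_trans ?_ (le_add_of_nonneg_right (hW i _).le)
      rw [hexp]
      apply Real.exp_le_exp.2
      rw [mul_comm 2, mul_assoc]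
      apply mul_le_mul_of_nonneg_left _ hm0.le
      nlinarith
    · refine le_trans ?_ (le_add_of_nonneg_left (hW i _).le)
      rw [hexp]
      apply Real.exp_le_exp.2
      rw [mul_comm 2, mul_assoc]
      apply mul_le_mul_of_nonneg_left _ hm0.le
      nlinarith
  calc (1 : ℝ) = (t : ℝ) ^ (-α) * (t : ℝ) ^ α := by
        rw [← Real.rpow_add ht0]; simp
    _ ≤ _ := mul_le_mul_of_nonneg_left hmain (by positivity)

end Weights

/-! ### Supermartingale bound and failure probability -/

section Concentration

variable {n : ℕ} {Ω : Type*} [mΩ : MeasurableSpace Ω] {μ : Measure Ω}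
  {p : Fin n → ℝ} {T : ℕ} {ℱ : Filtration ℕ mΩ} {X : ℕ → Fin n → Ω → ℝ}
  {S : ℕ → Ω → Finset (Fin n)}

theorem IsResponseModel.measurable' (hX : IsResponseModel μ p T ℱ X) {t : ℕ}
    (ht : t ∈ Finset.Icc 1 T) (i : Fin n) : Measurable (X t i) :=
  (hX.measurable t ht i).mono (ℱ.le t) le_rfl

theorem IsResponseModel.mem_Icc (hX : IsResponseModel μ p T ℱ X) {t : ℕ}
    (ht : t ∈ Finset.Icc 1 T) (i : Fin n) : ∀ᵐ ω ∂μ, X t i ω ∈ Set.Icc (0 : ℝ) 1 := by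
  filter_upwards [hX.zero_or_one t ht i] with ω hω
  rcases hω with h | h <;> simp [h]

theorem IsResponseModel.integral_eq (hX : IsResponseModel μ p T ℱ X) (hp : ∀ i, 0 ≤ p i) {t : ℕ}
    (ht : t ∈ Finset.Icc 1 T) (i : Fin n) : ∫ ω, X t i ω ∂μ = p i := by
  have hm : MeasurableSet {ω | X t i ω = 1} :=
    hX.measurable' ht i (measurableSet_singleton 1)
  have h : ∀ᵐ ω ∂μ, X t i ω = {ω | X t i ω = 1}.indicator (fun _ => (1 : ℝ)) ω := by
    filter_upwards [hX.zero_or_one t ht i] with ω hω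
    rcases hω with h | h <;> simp [h]
  rw [integral_congr_ae h, integral_indicator_const _ hm, Measure.real, hX.prob_one t ht i,
    ENNReal.toReal_ofReal (hp i)]
  simp

/-- Hoeffding's lemma for a response. -/
theorem IsResponseModel.lintegral_exp_le_one [IsProbabilityMeasure μ]
    (hX : IsResponseModel μ p T ℱ X)
    (hp : ∀ i, 0 ≤ p i) {t : ℕ} (ht : t ∈ Finset.Icc 1 T) (i : Fin n) (l : ℝ) :
    ∫⁻ ω, ENNReal.ofReal (Real.exp (l * (X t i ω - p i) - l ^ 2 / 8)) ∂μ ≤ 1 := by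
  -- The unit interval gives variance proxy `1/4`, which produces the compensator `l ^ 2 / 8`.
  have hsub := hasSubgaussianMGF_of_mem_Icc (hX.measurable' ht i).aemeasurable (hX.mem_Icc ht i)
  rw [hX.integral_eq hp ht i] at hsub
  have hint := hsub.integrable_exp_mul l
  have hle := hsub.mgf_le l
  have hrw : ∀ ω, Real.exp (l * (X t i ω - p i) - l ^ 2 / 8) =
      Real.exp (l * (X t i ω - p i)) * Real.exp (-(l ^ 2 / 8)) := fun ω => by
    rw [← Real.exp_add]; ring_nf
  simp_rw [hrw]
  rw [← ofReal_integral_eq_lintegral_ofReal (hint.mul_const _)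
    (Filter.Eventually.of_forall fun ω => by positivity), ENNReal.ofReal_le_one,
    integral_mul_const]
  rw [mgf] at hle
  calc _ ≤ _ := mul_le_mul_of_nonneg_right hle (Real.exp_pos _).le
    _ = 1 := by
      rw [← Real.exp_add, Real.exp_eq_one_iff]
      simp
      ring

theorem measurable_deviationWeight (hX : IsResponseModel μ p T ℱ X)
    (hS : ∀ t ∈ Finset.Icc 1 T, ∀ A : Finset (Fin n), MeasurableSet[ℱ (t - 1)] {ω | S t ω = A})
    (i : Fin n) (q l : ℝ) {t : ℕ} (ht : t ≤ T) :
    Measurable[ℱ t] (deviationWeight X S i q l t) := by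
  induction t with
  | zero =>
    have : deviationWeight X S i q l 0 = fun _ => 1 := by
      ext ω
      simp [deviationWeight, pullTimes_zero]
    rw [this]
    exact measurable_const
  | succ t ih =>
    have htI : t + 1 ∈ Finset.Icc 1 T := Finset.mem_Icc.2 ⟨by omega, ht⟩
    have hle : ℱ t ≤ ℱ (t + 1) := ℱ.mono (Nat.le_succ t)
    have h1 : Measurable[ℱ (t + 1)] (deviationWeight X S i q l t) :=
      (ih (by omega)).mono hle le_rfl
    have h2 : Measurable[ℱ (t + 1)] fun ω => if i ∈ S (t + 1) ω then
        Real.exp (l * (X (t + 1) i ω - q) - l ^ 2 / 8) else 1 := by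
      refine Measurable.ite (hle _ (measurableSet_mem_selection (hS _ htI) i)) ?_ measurable_const
      have := hX.measurable _ htI i
      exact Real.measurable_exp.comp (((this.sub_const _).const_mul _).sub_const _)
    have : deviationWeight X S i q l (t + 1) = fun ω => deviationWeight X S i q l t ω *
      if i ∈ S (t + 1) ω then Real.exp (l * (X (t + 1) i ω - q) - l ^ 2 / 8) else 1 :=
      funext fun ω => deviationWeight_succ i q l t ω
    rw [this]
    exact h1.mul h2

/-- Whether the arm is selected at time `t + 1` is known at time `t`, so the new factor is either
`1` or independent of the past with mean at most `1`. This handles the random, adaptive number of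
samples. -/
theorem lintegral_deviationWeight_le_one [IsProbabilityMeasure μ]
    (hX : IsResponseModel μ p T ℱ X) (hp : ∀ i, 0 ≤ p i)
    (hS : ∀ t ∈ Finset.Icc 1 T, ∀ A : Finset (Fin n), MeasurableSet[ℱ (t - 1)] {ω | S t ω = A})
    (i : Fin n) (l : ℝ) {t : ℕ} (ht : t ≤ T) :
    ∫⁻ ω, ENNReal.ofReal (deviationWeight X S i (p i) l t ω) ∂μ ≤ 1 := by
  induction t with
  | zero => simp [deviationWeight, pullTimes_zero]
  | succ t ih =>
    have htI : t + 1 ∈ Finset.Icc 1 T := Finset.mem_Icc.2 ⟨by omega, ht⟩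
    have ih := ih (by omega)
    have hW := measurable_deviationWeight hX hS i (p i) l (by omega : t ≤ T)
    have hA := measurableSet_mem_selection (hS _ htI) i
    rw [Nat.add_sub_cancel] at hA
    set A : Set Ω := {ω | i ∈ S (t + 1) ω} with hAdef
    set W : Ω → ℝ≥0∞ := fun ω => ENNReal.ofReal (deviationWeight X S i (p i) l t ω)
    set G : Ω → ℝ≥0∞ := fun ω =>
      ENNReal.ofReal (Real.exp (l * (X (t + 1) i ω - p i) - l ^ 2 / 8))
    have hWm : Measurable[ℱ t] W := hW.ennreal_ofReal
    have hsplit : ∀ ω, ENNReal.ofReal (deviationWeight X S i (p i) l (t + 1) ω) =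
        A.indicator W ω * G ω + Aᶜ.indicator W ω := by
      intro ω
      rw [deviationWeight_succ]
      by_cases h : ω ∈ A
      · have h' : i ∈ S (t + 1) ω := h
        rw [if_pos h', Set.indicator_of_mem h, Set.indicator_of_notMem (by simpa using h),
          add_zero, 
            ENNReal.ofReal_mul (deviationWeight_pos i (p i) l t ω).le]
      · have h' : i ∉ S (t + 1) ω := h
        rw [if_neg h', Set.indicator_of_notMem h, Set.indicator_of_mem (by simpa using h)]
        simp [W]
    have hcomap : MeasurableSpace.comap (fun ω i => X (t + 1) i ω)
        (inferInstance : MeasurableSpace (Fin n → ℝ)) ≤ mΩ :=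
      (measurable_pi_lambda _ fun i => hX.measurable' htI i).comap_le
    have hG : Measurable[MeasurableSpace.comap (fun ω i => X (t + 1) i ω)
        (inferInstance : MeasurableSpace (Fin n → ℝ))] G := by
      have : Measurable fun x : Fin n → ℝ =>
          ENNReal.ofReal (Real.exp (l * (x i - p i) - l ^ 2 / 8)) := by fun_prop
      exact this.comp (comap_measurable (fun ω i => X (t + 1) i ω))
    have hindep := (hX.indep_past _ htI).symm
    rw [Nat.add_sub_cancel] at hindep
    have hA' : MeasurableSet A := ℱ.le t _ hA
    have hWm' : Measurable W := hWm.mono (ℱ.le t) le_rfl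
    calc ∫⁻ ω, ENNReal.ofReal (deviationWeight X S i (p i) l (t + 1) ω) ∂μ
        = ∫⁻ ω, (A.indicator W ω * G ω + Aᶜ.indicator W ω) ∂μ := by simp_rw [hsplit]
      _ = (∫⁻ ω, A.indicator W ω * G ω ∂μ) + ∫⁻ ω, Aᶜ.indicator W ω ∂μ :=
          lintegral_add_right _ (hWm'.indicator hA'.compl)
      _ = (∫⁻ ω, A.indicator W ω ∂μ) * (∫⁻ ω, G ω ∂μ) + ∫⁻ ω, Aᶜ.indicator W ω ∂μ := by
          rw [lintegral_mul_eq_lintegral_mul_lintegral_of_independent_measurableSpace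
            (ℱ.le t) hcomap hindep (hWm.indicator hA) hG]
      _ ≤ (∫⁻ ω, A.indicator W ω ∂μ) * 1 + ∫⁻ ω, Aᶜ.indicator W ω ∂μ := by
          gcongr
          exact hX.lintegral_exp_le_one hp htI i l
      _ = ∫⁻ ω, W ω ∂μ := by
          rw [mul_one, lintegral_indicator hA', lintegral_indicator hA'.compl,
            lintegral_add_compl _ hA']
      _ ≤ 1 := ih

theorem integral_deviationWeight_le_one [IsProbabilityMeasure μ]
    (hX : IsResponseModel μ p T ℱ X) (hp : ∀ i, 0 ≤ p i)
    (hS : ∀ t ∈ Finset.Icc 1 T, ∀ A : Finset (Fin n), MeasurableSet[ℱ (t - 1)] {ω | S t ω = A})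
    (i : Fin n) (l : ℝ) {t : ℕ} (ht : t ≤ T) :
    Integrable (deviationWeight X S i (p i) l t) μ ∧
      ∫ ω, deviationWeight X S i (p i) l t ω ∂μ ≤ 1 := by
  have h := lintegral_deviationWeight_le_one hX hp hS i l ht
  have hm : Measurable (deviationWeight X S i (p i) l t) :=
    (measurable_deviationWeight hX hS i (p i) l ht).mono (ℱ.le t) le_rfl
  have h0 : 0 ≤ᵐ[μ] deviationWeight X S i (p i) l t :=
    Filter.Eventually.of_forall fun ω => (Real.exp_pos _).le
  refine ⟨⟨hm.aestronglyMeasurable, ?_⟩, ?_⟩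
  · rw [hasFiniteIntegral_iff_ofReal h0]
    exact h.trans_lt ENNReal.one_lt_top
  · rw [integral_eq_lintegral_of_nonneg_ae h0 hm.aestronglyMeasurable]
    exact ENNReal.toReal_le_of_le_ofReal zero_le_one (by simpa using h)

/-- The parameter `l` must be deterministic although the radius depends on a random count; hence the
sum over all `t - 1` possible positive counts. -/
theorem integral_failureBound_le [IsProbabilityMeasure μ]
    (hX : IsResponseModel μ p T ℱ X) (hp : ∀ i, 0 ≤ p i)
    (hS : ∀ t ∈ Finset.Icc 1 T, ∀ A : Finset (Fin n), MeasurableSet[ℱ (t - 1)] {ω | S t ω = A})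
    (α : ℝ) {t : ℕ} (ht : t ≤ T) :
    Integrable (failureBound α p X S t) μ ∧
      ∫ ω, failureBound α p X S t ω ∂μ ≤ 2 * n * ((t - 1 : ℕ) * (t : ℝ) ^ (-α)) := by
  have hW := fun i l => integral_deviationWeight_le_one hX hp hS i l (by omega : t - 1 ≤ T)
  have hint : ∀ i, ∀ m : ℕ, Integrable (fun ω => (t : ℝ) ^ (-α) *
      (deviationWeight X S i (p i) (4 * confidenceRadius α t m) (t - 1) ω +
        deviationWeight X S i (p i) (-(4 * confidenceRadius α t m)) (t - 1) ω)) μ :=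
    fun i m => ((hW i _).1.add (hW i _).1).const_mul _
  refine ⟨integrable_finsetSum _ fun i _ => integrable_finsetSum _ fun m _ => hint i m, ?_⟩
  unfold failureBound
  rw [integral_finsetSum _ fun i _ => integrable_finsetSum _ fun m _ => hint i m]
  calc _ ≤ ∑ i : Fin n, ∑ m ∈ Finset.Icc 1 (t - 1), (t : ℝ) ^ (-α) * 2 := by
        refine Finset.sum_le_sum fun i _ => ?_
        rw [integral_finsetSum _ fun m _ => hint i m]
        refine Finset.sum_le_sum fun m _ => ?_
        rw [integral_const_mul, integral_add (hW i _).1 (hW i _).1]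
        gcongr
        linarith [(hW i (4 * confidenceRadius α t m)).2,
          (hW i (-(4 * confidenceRadius α t m))).2]
    _ = _ := by
        simp only [Finset.sum_const, nsmul_eq_mul, Finset.card_fin, Nat.card_Icc,
          Nat.add_sub_cancel]
        ring

theorem sum_pred_mul_rpow_le {α : ℝ} (hα : 2 < α) (T : ℕ) :
    ∑ t ∈ Finset.Icc 1 T, ((t - 1 : ℕ) : ℝ) * (t : ℝ) ^ (-α) ≤ 1 / (α - 2) := by
  have hα' : 0 < α - 2 := by linarith
  rcases T with _ | T
  · simp only [zero_lt_one, Finset.Icc_eq_empty_of_lt, Finset.sum_empty]; positivity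
  have hrange : ∑ t ∈ Finset.Icc 1 (T + 1), ((t - 1 : ℕ) : ℝ) * (t : ℝ) ^ (-α) =
      ∑ k ∈ Finset.range T, ((k + 1 : ℕ) : ℝ) * ((k + 2 : ℕ) : ℝ) ^ (-α) := by
    rw [← Finset.Ico_add_one_right_eq_Icc, Finset.sum_Ico_eq_sum_range, Nat.add_sub_cancel,
      Finset.sum_range_succ']
    simp only [Nat.add_sub_cancel_left, Nat.sub_self, Nat.cast_zero, zero_mul, add_zero]
    refine Finset.sum_congr rfl fun k _ => ?_
    rw [show 1 + (k + 1) = k + 2 by omega]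
  rw [hrange]
  -- Bounding `k + 1` by `k + 2` leaves a pure power, compared with the integral of `x ^ (1 - α)`
  -- from `1`, which stays below `1 / (α - 2)`.
  calc _ ≤ ∑ k ∈ Finset.range T, ((1 : ℝ) + ((k + 1 : ℕ) : ℝ)) ^ (1 - α) := by
        refine Finset.sum_le_sum fun k _ => ?_
        have h2 : (0 : ℝ) < (k + 2 : ℕ) := by positivity
        rw [show (1 : ℝ) + ((k + 1 : ℕ) : ℝ) = (k + 2 : ℕ) by push_cast; ring,
          sub_eq_add_neg, Real.rpow_add h2, Real.rpow_one]
        gcongr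
        omega
    _ ≤ ∫ x in (1 : ℝ)..1 + (T : ℝ), x ^ (1 - α) := by
        refine AntitoneOn.sum_le_integral (f := fun x : ℝ => x ^ (1 - α)) ?_
        intro x hx y hy hxy
        exact Real.rpow_le_rpow_of_nonpos (by linarith [hx.1]) hxy (by linarith)
    _ ≤ 1 / (α - 2) := by
        rw [integral_rpow (Or.inr ⟨by linarith, by
          rw [Set.uIcc_of_le (by simp)]; simp⟩)]
        have h1 : (0 : ℝ) ≤ (1 + (T : ℝ)) ^ (1 - α + 1) := by positivity
        rw [Real.one_rpow, ← neg_div_neg_eq, show -(1 - α + 1) = α - 2 by ring]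
        gcongr
        linarith

end Concentration

end DemandResponse

namespace DemandResponse

/-! ### Expected loss of fixed and of past-determined selections -/

theorem eq_sum_indicator_fiber {n : ℕ} {Ω : Type*} {R : Ω → Finset (Fin n)}
    (f : Finset (Fin n) → Ω → ℝ) (ω : Ω) :
    f (R ω) ω = ∑ A : Finset (Fin n), {ω | R ω = A}.indicator (f A) ω := by
  simp [Set.indicator_apply]

section Loss

variable {n : ℕ} {Ω : Type*} [mΩ : MeasurableSpace Ω] {μ : Measure Ω}
  {p : Fin n → ℝ} {T : ℕ} {ℱ : Filtration ℕ mΩ} {X : ℕ → Fin n → Ω → ℝ}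

theorem Mbar_nonneg (n : ℕ) (Dbar : ℝ) : 0 ≤ Mbar n Dbar :=
  (sq_nonneg _).trans (le_max_left _ _)

theorem measurable_loss (d : ℝ) (A : Finset (Fin n)) : Measurable fun x => loss d x A := by
  unfold loss
  fun_prop

theorem loss_nonneg (d : ℝ) (x : Fin n → ℝ) (A : Finset (Fin n)) : 0 ≤ loss d x A :=
  sq_nonneg _

theorem loss_le_Mbar {d Dbar : ℝ} (hd : 0 ≤ d) (hdD : d ≤ Dbar) {x : Fin n → ℝ}
    (hx : ∀ i, x i ∈ Set.Icc (0 : ℝ) 1) (A : Finset (Fin n)) : loss d x A ≤ Mbar n Dbar := by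
  have h0 : 0 ≤ ∑ i ∈ A, x i := Finset.sum_nonneg fun i _ => (hx i).1
  have h1 : ∑ i ∈ A, x i ≤ n := by
    calc ∑ i ∈ A, x i ≤ ∑ i ∈ A, (1 : ℝ) := Finset.sum_le_sum fun i _ => (hx i).2
      _ = (A.card : ℝ) := by simp
      _ ≤ n := by exact_mod_cast (by simpa using Finset.card_le_univ A : A.card ≤ n)
  unfold loss Mbar
  rcases le_total (∑ i ∈ A, x i) d with h | h
  · refine le_trans ?_ (le_max_left _ _)
    nlinarith
  · refine le_trans ?_ (le_max_right _ _)
    nlinarith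

theorem IsResponseModel.ae_loss_mem_Icc (hX : IsResponseModel μ p T ℱ X) {t : ℕ}
    (ht : t ∈ Finset.Icc 1 T) {d Dbar : ℝ} (hd : 0 ≤ d) (hdD : d ≤ Dbar) :
    ∀ᵐ ω ∂μ, ∀ A, loss d (fun i => X t i ω) A ∈ Set.Icc 0 (Mbar n Dbar) := by
  filter_upwards [ae_all_iff.2 (hX.mem_Icc ht)] with ω hω A
  exact ⟨loss_nonneg _ _ _, loss_le_Mbar hd hdD hω A⟩

variable [IsProbabilityMeasure μ]

theorem IsResponseModel.integrable_loss (hX : IsResponseModel μ p T ℱ X) {t : ℕ}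
    (ht : t ∈ Finset.Icc 1 T) {d Dbar : ℝ} (hd : 0 ≤ d) (hdD : d ≤ Dbar) (A : Finset (Fin n)) :
    Integrable (fun ω => loss d (fun i => X t i ω) A) μ := by
  refine Integrable.of_mem_Icc 0 (Mbar n Dbar) ?_ ?_
  · exact ((measurable_loss d A).comp
      (measurable_pi_lambda _ fun i => hX.measurable' ht i)).aemeasurable
  · filter_upwards [hX.ae_loss_mem_Icc ht hd hdD] with ω hω using hω A

theorem IsResponseModel.integral_loss (hX : IsResponseModel μ p T ℱ X) (hp : ∀ i, 0 ≤ p i) {t : ℕ}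
    (ht : t ∈ Finset.Icc 1 T) (d : ℝ) (A : Finset (Fin n)) :
    ∫ ω, loss d (fun i => X t i ω) A ∂μ = expectedLoss p d A := by
  have hL : ∀ i, MemLp (X t i) 2 μ := fun i =>
    memLp_of_bounded (hX.mem_Icc ht i) (hX.measurable' ht i).aestronglyMeasurable 2
  have hvar : ∀ i, variance (X t i) μ = p i * (1 - p i) := by
    intro i
    have hsq : ∀ᵐ ω ∂μ, (X t i ^ 2) ω = X t i ω := by
      filter_upwards [hX.zero_or_one t ht i] with ω hω
      rcases hω with h | h <;> simp [h]
    rw [variance_eq_sub (hL i), integral_congr_ae hsq, hX.integral_eq hp ht i]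
    ring
  set Y : Ω → ℝ := ∑ i ∈ A, X t i with hY
  have hYm : Measurable Y := by
    rw [hY, Finset.sum_fn]
    exact Finset.measurable_sum _ fun i _ => hX.measurable' ht i
  have hYL : MemLp Y 2 μ := memLp_finsetSum' _ fun i _ => hL i
  have hYvar : variance Y μ = ∑ i ∈ A, p i * (1 - p i) := by
    rw [hY, IndepFun.variance_sum (fun i _ => hL i)
      fun i _ j _ hij => (hX.indep_customers t ht).indepFun hij]
    exact Finset.sum_congr rfl fun i _ => hvar i
  have hYint : ∫ ω, Y ω ∂μ = ∑ i ∈ A, p i := by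
    simp only [hY, Finset.sum_apply]
    rw [integral_finsetSum _ fun i _ => (hL i).integrable (by norm_num)]
    exact Finset.sum_congr rfl fun i _ => hX.integral_eq hp ht i
  -- Bias-variance decomposition: the second moment of `Y - d` is its variance, unchanged by the
  -- shift, plus its squared mean.
  have h := variance_sub_const (μ := μ) hYm.aestronglyMeasurable d
  have hYd : MemLp (fun ω => Y ω - d) 2 μ := hYL.sub (memLp_const d)
  rw [variance_eq_sub hYd, hYvar,
    integral_sub (hYL.integrable (by norm_num)) (integrable_const d), hYint] at h
  have hloss : ∀ ω, loss d (fun i => X t i ω) A = ((fun ω => Y ω - d) ^ 2) ω := fun ω => by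
    simp [loss, hY]
  simp_rw [hloss]
  rw [expectedLoss]
  simp only [integral_const, probReal_univ, one_smul] at h
  linarith

theorem IsResponseModel.expectedLoss_mem_Icc (hX : IsResponseModel μ p T ℱ X)
    (hp : ∀ i, 0 ≤ p i) {t : ℕ}
    (ht : t ∈ Finset.Icc 1 T) {d Dbar : ℝ} (hd : 0 ≤ d) (hdD : d ≤ Dbar) (A : Finset (Fin n)) :
    expectedLoss p d A ∈ Set.Icc 0 (Mbar n Dbar) := by
  rw [← hX.integral_loss hp ht d A]
  refine ⟨integral_nonneg fun ω => loss_nonneg _ _ _, ?_⟩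
  calc _ ≤ ∫ _, Mbar n Dbar ∂μ := by
        refine integral_mono_ae (hX.integrable_loss ht hd hdD A) (integrable_const _) ?_
        filter_upwards [hX.ae_loss_mem_Icc ht hd hdD] with ω hω using (hω A).2
    _ = _ := by simp

variable {R : Ω → Finset (Fin n)}

/-- The expected loss of a selection that is determined by past information. -/
theorem IsResponseModel.integral_loss_selection (hX : IsResponseModel μ p T ℱ X)
    (hp : ∀ i, 0 ≤ p i) {t : ℕ} (ht : t ∈ Finset.Icc 1 T) {d Dbar : ℝ} (hd : 0 ≤ d)
    (hdD : d ≤ Dbar) (hR : ∀ A : Finset (Fin n), MeasurableSet[ℱ (t - 1)] {ω | R ω = A}) :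
    Integrable (fun ω => loss d (fun i => X t i ω) (R ω)) μ ∧
    Integrable (fun ω => expectedLoss p d (R ω)) μ ∧
      ∫ ω, loss d (fun i => X t i ω) (R ω) ∂μ = ∫ ω, expectedLoss p d (R ω) ∂μ := by
  have hR' : ∀ A : Finset (Fin n), MeasurableSet {ω | R ω = A} := fun A => ℱ.le _ _ (hR A)
  have h1 : ∀ ω, loss d (fun i => X t i ω) (R ω) = ∑ A : Finset (Fin n),
      {ω | R ω = A}.indicator (fun ω => loss d (fun i => X t i ω) A) ω :=
    eq_sum_indicator_fiber fun A ω => loss d (fun i => X t i ω) A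
  have h2 : ∀ ω, expectedLoss p d (R ω) = ∑ A : Finset (Fin n),
      {ω | R ω = A}.indicator (fun _ => expectedLoss p d A) ω :=
    eq_sum_indicator_fiber fun A _ => expectedLoss p d A
  have hi1 : ∀ A : Finset (Fin n), Integrable
      ({ω | R ω = A}.indicator fun ω => loss d (fun i => X t i ω) A) μ :=
    fun A => (hX.integrable_loss ht hd hdD A).indicator (hR' A)
  have hi2 : ∀ A : Finset (Fin n), Integrable
      ({ω | R ω = A}.indicator fun _ => expectedLoss p d A) μ :=
    fun A => (integrable_const _).indicator (hR' A)
  simp_rw [h1, h2]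
  refine ⟨integrable_finsetSum _ fun A _ => hi1 A, integrable_finsetSum _ fun A _ => hi2 A, ?_⟩
  rw [integral_finsetSum _ fun A _ => hi1 A, integral_finsetSum _ fun A _ => hi2 A]
  refine Finset.sum_congr rfl fun A _ => ?_
  rw [integral_indicator (hR' A), integral_indicator (hR' A), setIntegral_const,
    Indep.setIntegral_eq_mul (f := fun x => loss d x A) (ℱ.le (t - 1)) (hX.indep_past t ht).symm
      (measurable_pi_lambda _ fun i => hX.measurable' ht i).aemeasurable (hR A)
      (measurable_loss d A).aestronglyMeasurable, hX.integral_loss hp ht, smul_eq_mul]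

end Loss

/-! ### Assembling the regret bound -/

section Regret

variable {n : ℕ} {p : Fin n → ℝ} {α Dbar : ℝ}

theorem explorationTerm_nonneg (T : ℕ) : 0 ≤ explorationTerm p α T :=
  ENNReal.toReal_nonneg

/-- The instance-dependent factor of `log T` in the exploration term. -/
theorem explorationTerm_eq_mul_log (hα : 0 ≤ α) (T : ℕ) :
    explorationTerm p α T = α / (2 * (eps1 p).toReal ^ 2) * Real.log T := by
  rw [explorationTerm_eq α hα]
  ring

theorem regretBound_le (hα : 2 < α) {T : ℕ} (hT : 2 < T) :
    regretBound p α Dbar T ≤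
      (Mbar n Dbar * n + 2 * Mbar n Dbar * n / (α - 2)
        + Mbar n Dbar * n * (α / (2 * (eps1 p).toReal ^ 2))
        + 2 * (n : ℝ) ^ 2 * √(2 * α) * √(1 + α / (2 * (eps1 p).toReal ^ 2)))
        * √((T : ℝ) * Real.log T) := by
  have hM := Mbar_nonneg n Dbar
  have hα' : 0 < α - 2 := by linarith
  set K := α / (2 * (eps1 p).toReal ^ 2) with hK
  have hK0 : 0 ≤ K := by positivity
  have hT' : (3 : ℝ) ≤ T := by exact_mod_cast hT
  -- This is where `T ≥ 3 > e` enters: it lets `√(T log T)` absorb the constant terms and `log T`.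
  have hlog1 : 1 ≤ Real.log T := by
    rw [Real.le_log_iff_exp_le (by linarith)]
    linarith [Real.exp_one_lt_d9]
  have hlogT : Real.log T ≤ T := (Real.log_le_sub_one_of_pos (by linarith)).trans (by linarith)
  have hR1 : 1 ≤ √((T : ℝ) * Real.log T) := by
    rw [Real.one_le_sqrt]; nlinarith
  have hRlog : Real.log T ≤ √((T : ℝ) * Real.log T) := by
    apply Real.le_sqrt_of_sq_le; nlinarith
  have hroot : √(2 * α * Real.log T) * √((T : ℝ) + K * Real.log T) ≤
      √(2 * α) * √(1 + K) * √((T : ℝ) * Real.log T) := by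
    rw [← Real.sqrt_mul (by nlinarith), ← Real.sqrt_mul (by linarith),
      ← Real.sqrt_mul (by nlinarith)]
    apply Real.sqrt_le_sqrt
    have : (T : ℝ) + K * Real.log T ≤ (1 + K) * T := by
      nlinarith [mul_le_mul_of_nonneg_left hlogT hK0]
    calc 2 * α * Real.log T * ((T : ℝ) + K * Real.log T)
        ≤ 2 * α * Real.log T * ((1 + K) * T) :=
          mul_le_mul_of_nonneg_left this (by nlinarith)
      _ = _ := by ring
  rw [regretBound, explorationTerm_eq_mul_log (by linarith), ← hK]
  have h1 : Mbar n Dbar * n ≤ Mbar n Dbar * n * √((T : ℝ) * Real.log T) :=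
    le_mul_of_one_le_right (by positivity) hR1
  have h2 : 2 * Mbar n Dbar * n / (α - 2) ≤
      2 * Mbar n Dbar * n / (α - 2) * √((T : ℝ) * Real.log T) :=
    le_mul_of_one_le_right (by positivity) hR1
  have h3 : Mbar n Dbar * n * (K * Real.log T) ≤
      Mbar n Dbar * n * (K * √((T : ℝ) * Real.log T)) := by gcongr
  have h4 := mul_le_mul_of_nonneg_left hroot (by positivity : 0 ≤ 2 * (n : ℝ) ^ 2)
  linarith

theorem sum_bound_le_regretBound (T : ℕ) :
    Mbar n Dbar * (2 * n * (1 / (α - 2))) +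
      n * (Mbar n Dbar + Mbar n Dbar * explorationTerm p α T +
        √(2 * α * Real.log T) * (2 * √(T : ℝ))) ≤ regretBound p α Dbar T := by
  have hN := explorationTerm_nonneg (p := p) (α := α) T
  have hn : (n : ℝ) ≤ (n : ℝ) ^ 2 := by exact_mod_cast Nat.le_self_pow two_ne_zero n
  have hc := Real.sqrt_nonneg (2 * α * Real.log T)
  -- The charging argument gives the sharper `n √T`; it is relaxed to the stated `n ^ 2 √(T + N)`,
  -- with `N` the exploration term.
  have h : n * (√(2 * α * Real.log T) * (2 * √(T : ℝ))) ≤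
      (n : ℝ) ^ 2 * (√(2 * α * Real.log T) * (2 * √((T : ℝ) + explorationTerm p α T))) := by
    gcongr
    linarith
  unfold regretBound
  have h1 : Mbar n Dbar * (2 * n * (1 / (α - 2))) = 2 * Mbar n Dbar * n / (α - 2) := by ring
  linarith

variable {Ω : Type*} [mΩ : MeasurableSpace Ω] {μ : Measure Ω} [IsProbabilityMeasure μ]
  {T : ℕ} {D : ℕ → ℝ} {ℱ : Filtration ℕ mΩ} {X : ℕ → Fin n → Ω → ℝ} {S : ℕ → Ω → Finset (Fin n)}
  {Sopt : ℕ → Finset (Fin n)}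

theorem integrable_totalExcessLoss (hp : ∀ i, 0 ≤ p i)
    (hD : ∀ t ∈ Finset.Icc 1 T, 0 < D t ∧ D t ≤ Dbar) (hX : IsResponseModel μ p T ℱ X)
    (hS : ∀ t ∈ Finset.Icc 1 T, ∀ A : Finset (Fin n), MeasurableSet[ℱ (t - 1)] {ω | S t ω = A}) :
    Integrable (totalExcessLoss D X S Sopt T) μ :=
  integrable_finsetSum _ fun t ht =>
    (hX.integral_loss_selection hp ht (hD t ht).1.le (hD t ht).2 (hS t ht)).1.sub
      (hX.integrable_loss ht (hD t ht).1.le (hD t ht).2 (Sopt t))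

theorem regret_eq_integral_sum (hp : ∀ i, 0 ≤ p i)
    (hD : ∀ t ∈ Finset.Icc 1 T, 0 < D t ∧ D t ≤ Dbar) (hX : IsResponseModel μ p T ℱ X)
    (hS : ∀ t ∈ Finset.Icc 1 T, ∀ A : Finset (Fin n), MeasurableSet[ℱ (t - 1)] {ω | S t ω = A}) :
    Integrable (fun ω => ∑ t ∈ Finset.Icc 1 T,
      (expectedLoss p (D t) (S t ω) - expectedLoss p (D t) (Sopt t))) μ ∧
    regret μ D X S Sopt T = ∫ ω, ∑ t ∈ Finset.Icc 1 T,
      (expectedLoss p (D t) (S t ω) - expectedLoss p (D t) (Sopt t)) ∂μ := by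
  have hsel := fun t ht =>
    hX.integral_loss_selection hp ht (hD t ht).1.le (hD t ht).2 (hS t ht)
  have hopt := fun t ht => hX.integrable_loss ht (hD t ht).1.le (hD t ht).2 (Sopt t)
  have hl : ∀ t ∈ Finset.Icc 1 T, Integrable (fun ω => loss (D t) (fun i => X t i ω) (S t ω) -
      loss (D t) (fun i => X t i ω) (Sopt t)) μ := fun t ht => (hsel t ht).1.sub (hopt t ht)
  have hi : ∀ t ∈ Finset.Icc 1 T, Integrable (fun ω =>
      expectedLoss p (D t) (S t ω) - expectedLoss p (D t) (Sopt t)) μ :=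
    fun t ht => (hsel t ht).2.1.sub (integrable_const _)
  refine ⟨integrable_finsetSum _ hi, ?_⟩
  unfold regret totalExcessLoss
  rw [integral_finsetSum _ hl, integral_finsetSum _ hi]
  refine Finset.sum_congr rfl fun t ht => ?_
  rw [integral_sub (hsel t ht).1 (hopt t ht), (hsel t ht).2.2, hX.integral_loss hp ht,
    integral_sub (hsel t ht).2.1 (integrable_const _)]
  simp

theorem regret_le_regretBound (hp : ∀ i, 0 ≤ p i ∧ p i ≤ 1) (hα : 2 < α)
    (hD : ∀ t ∈ Finset.Icc 1 T, 0 < D t ∧ D t ≤ Dbar) (hX : IsResponseModel μ p T ℱ X)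
    (hS : IsCUCBAvg α D T ℱ X S) :
    regret μ D X S Sopt T ≤ regretBound p α Dbar T := by
  have hM := Mbar_nonneg n Dbar
  have hα0 : 0 ≤ α := by linarith
  have hp0 := fun i => (hp i).1
  obtain ⟨hint, heq⟩ := regret_eq_integral_sum (Sopt := Sopt) hp0 hD hX hS.predictable
  have hF := fun t (ht : t ∈ Finset.Icc 1 T) =>
    integral_failureBound_le hX hp0 hS.predictable α (Finset.mem_Icc.1 ht).2
  set N := explorationTerm p α T with hNdef
  set c := √(2 * α * Real.log T) with hcdef
  set K : ℝ := n * (Mbar n Dbar + Mbar n Dbar * N + c * (2 * √(T : ℝ))) with hK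
  -- A pathwise bound: a step with a failed interval is paid by `failureBound ≥ 1`, every other step
  -- by its charges, which sum to at most the deterministic `K`.
  have hpath : ∀ ω, ∑ t ∈ Finset.Icc 1 T,
      (expectedLoss p (D t) (S t ω) - expectedLoss p (D t) (Sopt t)) ≤
      Mbar n Dbar * ∑ t ∈ Finset.Icc 1 T, failureBound α p X S t ω + K := by
    intro ω
    have hc : 0 ≤ c := Real.sqrt_nonneg _
    have hN : 0 ≤ N := explorationTerm_nonneg T
    have hcount := sum_selectionCost_le (fun τ => S τ ω) hM hN hc T
    refine le_trans ?_ (add_le_add_right hcount _)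
    rw [Finset.mul_sum, ← Finset.sum_add_distrib]
    refine Finset.sum_le_sum fun t ht => ?_
    obtain ⟨ht1, htT⟩ := Finset.mem_Icc.1 ht
    have hMB : expectedLoss p (D t) (S t ω) - expectedLoss p (D t) (Sopt t) ≤ Mbar n Dbar := by
      have h1 := hX.expectedLoss_mem_Icc hp0 ht (hD t ht).1.le (hD t ht).2 (S t ω)
      have h2 := hX.expectedLoss_mem_Icc hp0 ht (hD t ht).1.le (hD t ht).2 (Sopt t)
      linarith [h1.2, h2.1]
    have hF0 := failureBound_nonneg (p := p) (X := X) (S := S) α t ω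
    by_cases hbad : ∃ i, pulls (fun τ => S τ ω) i (t - 1) ≠ 0 ∧
        confidenceRadius α t (pulls (fun τ => S τ ω) i (t - 1)) <
          |sampleMean (fun τ => S τ ω) (fun τ i => X τ i ω) i (t - 1) - p i|
    · have h1 := one_le_failureBound hα0 ht1 hbad
      have h2 : 0 ≤ ∑ i ∈ S t ω, selectionCost (Mbar n Dbar) N c
          (pulls (fun τ => S τ ω) i (t - 1)) :=
        Finset.sum_nonneg fun i _ => selectionCost_nonneg hM hc _
      nlinarith
    · push Not at hbad
      have h := expectedLoss_step_le hp hα0 ht1 htT (hS.step t ht ω) (B := Sopt t) hM hMB hbad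
      exact h.trans (le_add_of_nonneg_left (mul_nonneg hM hF0))
  have hFint : Integrable (fun ω => ∑ t ∈ Finset.Icc 1 T, failureBound α p X S t ω) μ :=
    integrable_finsetSum _ fun t ht => (hF t ht).1
  have hFle : ∫ ω, ∑ t ∈ Finset.Icc 1 T, failureBound α p X S t ω ∂μ ≤
      2 * n * (1 / (α - 2)) := by
    rw [integral_finsetSum _ fun t ht => (hF t ht).1]
    refine (Finset.sum_le_sum fun t ht => (hF t ht).2).trans ?_
    rw [← Finset.mul_sum]
    exact mul_le_mul_of_nonneg_left (sum_pred_mul_rpow_le hα T) (by positivity)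
  rw [heq]
  calc _ ≤ ∫ ω, (Mbar n Dbar * ∑ t ∈ Finset.Icc 1 T, failureBound α p X S t ω + K) ∂μ :=
        integral_mono hint ((hFint.const_mul _).add (integrable_const K)) hpath
    _ = Mbar n Dbar * ∫ ω, ∑ t ∈ Finset.Icc 1 T, failureBound α p X S t ω ∂μ + K := by
        rw [integral_add (hFint.const_mul _) (integrable_const K), integral_const_mul]
        simp
    _ ≤ Mbar n Dbar * (2 * n * (1 / (α - 2))) + K := by gcongr
    _ ≤ _ := sum_bound_le_regretBound T

end Regret

end DemandResponse

theorem theorem3 {n : ℕ} (p : Fin n → ℝ) (hp : ∀ i, 0 ≤ p i ∧ p i ≤ 1)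
    (α : ℝ) (hα : 2 < α) (Dbar : ℝ) (hDbar : 0 < Dbar) :
    ∃ C : ℝ, ∀ (T : ℕ), 2 < T →
      ∀ (D : ℕ → ℝ), (∀ t ∈ Finset.Icc 1 T, 0 < D t ∧ D t ≤ Dbar) →
      ∀ {Ω : Type*} [mΩ : MeasurableSpace Ω] (μ : Measure Ω) [IsProbabilityMeasure μ]
        (ℱ : Filtration ℕ mΩ) (X : ℕ → Fin n → Ω → ℝ) (S : ℕ → Ω → Finset (Fin n))
        (Sopt : ℕ → Finset (Fin n)),
        DemandResponse.IsResponseModel μ p T ℱ X →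
        DemandResponse.IsCUCBAvg α D T ℱ X S →
        (∀ t ∈ Finset.Icc 1 T, DemandResponse.IsOptimal μ D X t (Sopt t)) →
        Integrable (DemandResponse.totalExcessLoss D X S Sopt T) μ ∧
        DemandResponse.regret μ D X S Sopt T ≤ DemandResponse.regretBound p α Dbar T ∧
        DemandResponse.regret μ D X S Sopt T ≤ C * √((T : ℝ) * Real.log T) := by
  exact ⟨_, fun T hT D hD Ω mΩ μ _ ℱ X S Sopt hX hS _ =>
    have h := DemandResponse.regret_le_regretBound hp hα hD hX hS
    ⟨DemandResponse.integrable_totalExcessLoss (fun i => (hp i).1) hD hX hS.predictable, h,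
      h.trans (DemandResponse.regretBound_le hα hT)⟩⟩
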